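/- **Theorem (error bound of the truncated two-sided quaternion HOSVD).** *Notation.* Let $\mathbb H$ be the quaternions, $N=2m$, $\mathcal T\in\mathbb H^{I_1\times\cdots\times I_N}$, and let $I'_1,\dots,I'_N$ be truncation ranks with $I'_j\le I_j$. For a tensor $\mathcal A$, $\|\mathcal A\|_F^2=\sum|a_{i_1\cdots i_N}|^2$; the left mode-$k$ unfolding $\mathcal A^L_{[k]}$ is the matrix whose rows are indexed by $i_k$ and whose columns are indexed by the remaining indices (its columns are the mode-$k$ fibers), and the right unfolding is $\mathcal A^R_{[k]}=(\mathcal A^L_{[k]})^T$. The left and right mode-$k$ products are $$(\mathbf U\times^L_k\mathcal A)_{\cdots j\cdots}=\sum_{i_k}u_{j i_k}a_{\cdots i_k\cdots},\qquad (\mathcal A\times^R_k\mathbf V)_{\cdots j\cdots}=\sum_{i_k}a_{\cdots i_k\cdots}v_{i_k j}.$$ Left products are applied successively from the innermost to the outermost; the same holds for right products. *Truncated decomposition.* Put $\hat{\mathcal T}_{m+1}=\mathcal T$. For $k=m,m-1,\dots,1$, with $k'=N-k+1$, take any singular value decompositions $$(\hat{\mathcal T}_{k+1})^L_{[k]}=\mathbf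 U_k\Sigma^L_k\mathbf V_k^H,\qquad (\hat{\mathcal T}_{k+1})^R_{[k']}=\mathbf U_{k'}\Sigma^R_{k'}\mathbf V_{k'}^H$$ with square unitary quaternion matrices $\mathbf U_k,\mathbf V_k,\mathbf U_{k'},\mathbf V_{k'}$ and rectangular diagonal matrices $\Sigma^L_k,\Sigma^R_{k'}$ whose diagonal entries are the singular values in decreasing order. Write $\mathbf U_k=[\hat{\mathbf U}_k,\tilde{\mathbf U}_k]$ and $\mathbf V_{k'}=[\hat{\mathbf V}_{k'},\tilde{\mathbf V}_{k'}]$, where $\hat{\mathbf U}_k$ consists of the first $I'_k$ columns of $\mathbf U_k$ and $\hat{\mathbf V}_{k'}$ of the first $I'_{k'}$ columns of $\mathbf V_{k'}$; let $\tilde\Sigma^L_k$ be $\Sigma^L_k$ without its first $I'_k$ rows and $\tilde\Sigma^R_{k'}$ be $\Sigma^R_{k'}$ without its first $I'_{k'}$ columns. Set $$\hat{\mathcal T}_k=\hat{\mathbf U}_k^H\times^L_k\hat{\mathcal T}_{k+1}\times^R_{k'}\hat{\mathbf V}_{k'} .$$ The residual tensors $\mathcal E^L_k,\mathcal E^R_{k'}$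 (of the same size as $\hat{\mathcal T}_{k+1}$) are defined by $$(\mathcal E^L_k)^L_{[k]}=\tilde{\mathbf U}_k\tilde\Sigma^L_k\mathbf V_k^H,\qquad (\mathcal E^R_{k'})^R_{[k']}=\mathbf U_{k'}\tilde\Sigma^R_{k'}\tilde{\mathbf V}_{k'}^H .$$ Finally let $\hat{\mathcal S}=\hat{\mathcal T}_1\in\mathbb H^{I'_1\times\cdots\times I'_N}$ and $$\hat{\mathcal T}=\hat{\mathbf U}_m\times^L_m\cdots\hat{\mathbf U}_1\times^L_1\hat{\mathcal S}\times^R_N\hat{\mathbf V}_N^H\cdots\times^R_{m+1}\hat{\mathbf V}_{m+1}^H .$$ *Claim.* For every such decomposition, $$\begin{aligned} \|\mathcal T-\hat{\mathcal T}\|_F^2 &=\sum_{k=1}^m\|\mathcal E^L_k\|_F^2+\sum_{k=1}^m\|\hat{\mathbf U}_k^H\times^L_k\mathcal E^R_{N-k+1}\|_F^2\\ &=\sum_{k=1}^m\|\mathcal E^L_k\times^R_{N-k+1}\hat{\mathbf V}_{N-k+1}\|_F^2+\sum_{k=1}^m\|\mathcal E^R_{N-k+1}\|_F^2\\ &\le\sum_{k=1}^m\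 \sum_{i=I'_k+1}^{I_k}\big((\sigma^L_i)^{(k)}\big)^2+\sum_{k=m+1}^{N}\ \sum_{i=I'_k+1}^{I_k}\big((\sigma^R_i)^{(k)}\big)^2, \end{aligned}$$ where $(\sigma^L_i)^{(k)}$ and $(\sigma^R_i)^{(k)}$ are the $i$-th largest singular values in $\Sigma^L_k$ and $\Sigma^R_k$ (zero if $i$ exceeds the number of diagonal entries). -/

import Mathlib

open scoped Quaternion Matrix

noncomputable section

namespace TSQHOSVD

/-! ### Quaternion tensors -/

/-- Quaternion tensors of order `N` with dimensions `d 0, …, d (N - 1)`. -/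
abbrev Tensor {N : ℕ} (d : Fin N → ℕ) : Type := (∀ j, Fin (d j)) → ℍ[ℝ]

/-- The Frobenius norm `‖A‖_F = (∑ |a_{i₁⋯i_N}|²)^{1/2}`. -/
def frobNorm {N : ℕ} {d : Fin N → ℕ} (A : Tensor d) : ℝ := Real.sqrt (∑ i, ‖A i‖ ^ 2)

/-- Transport of a tensor along a pointwise equality of its dimensions; the entries are unchanged. -/
def Tensor.castDims {N : ℕ} {d e : Fin N → ℕ} (h : ∀ j, e j = d j) (A : Tensor d) : Tensor e :=
  fun i => A fun j => Fin.cast (h j) (i j)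

/-! ### Left and right unfoldings -/

/-- The increasing enumeration of the modes different from `k`. -/
def otherModes {N : ℕ} (k : Fin N) : Fin (Fintype.card {j : Fin N // j ≠ k}) ≃o {j : Fin N // j ≠ k} :=
  monoEquivOfFin _ rfl

/-- The product `∏_{j ≠ k} d j`. -/
def codim {N : ℕ} (d : Fin N → ℕ) (k : Fin N) : ℕ := ∏ l, d (otherModes k l)

/-- The bijection sending a multi-index `i` to the pair consisting of its `k`-th component and of the
position `∑_{l ≠ k} i_l J_l`, `J_l = ∏_{m < l, m ≠ k} d m` (everything counted from `0`), of the
remaining components. -/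
def splitIndex {N : ℕ} (d : Fin N → ℕ) (k : Fin N) :
    (∀ j, Fin (d j)) ≃ Fin (d k) × Fin (codim d k) :=
  (Equiv.piSplitAt k fun j => Fin (d j)).trans <|
    Equiv.prodCongr (Equiv.refl _) <|
      ((otherModes k).toEquiv.piCongrLeft (fun j : {j // j ≠ k} => Fin (d j))).symm.trans
        finPiFinEquiv

theorem splitIndex_fst {N : ℕ} (d : Fin N → ℕ) (k : Fin N) (i : ∀ j, Fin (d j)) :
    (splitIndex d k i).1 = i k := rfl

theorem splitIndex_snd {N : ℕ} (d : Fin N → ℕ) (k : Fin N) (i : ∀ j, Fin (d j)) :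
    ((splitIndex d k i).2 : ℕ) = ∑ l, (i (otherModes k l) : ℕ) *
      ∏ x : Fin l, d (otherModes k (Fin.castLE l.2.le x)) :=
  finPiFinEquiv_apply _

/-- The left mode-`k` unfolding `T^L_[k]`, a `d k × ∏_{j ≠ k} d j` matrix whose columns are the
mode-`k` fibers. The equation `hk` allows the number of rows to be called `K` instead of `d k`. -/
def unfoldL {N : ℕ} {d : Fin N → ℕ} {K : ℕ} (k : Fin N) (hk : d k = K) (T : Tensor d) :
    Matrix (Fin K) (Fin (codim d k)) ℍ[ℝ] :=
  fun a c => T ((splitIndex d k).symm (Fin.cast hk.symm a, c))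

/-- The right mode-`k` unfolding `T^R_[k]`, a `∏_{j ≠ k} d j × d k` matrix whose rows are the
mode-`k` fibers. -/
def unfoldR {N : ℕ} {d : Fin N → ℕ} {K : ℕ} (k : Fin N) (hk : d k = K) (T : Tensor d) :
    Matrix (Fin (codim d k)) (Fin K) ℍ[ℝ] :=
  fun c a => T ((splitIndex d k).symm (Fin.cast hk.symm a, c))

/-- The tensor with a given left mode-`k` unfolding. -/
def foldL {N : ℕ} {d : Fin N → ℕ} {K : ℕ} (k : Fin N) (hk : d k = K)
    (M : Matrix (Fin K) (Fin (codim d k)) ℍ[ℝ]) : Tensor d :=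
  fun i => M (Fin.cast hk (splitIndex d k i).1) (splitIndex d k i).2

/-- The tensor with a given right mode-`k` unfolding. -/
def foldR {N : ℕ} {d : Fin N → ℕ} {K : ℕ} (k : Fin N) (hk : d k = K)
    (M : Matrix (Fin (codim d k)) (Fin K) ℍ[ℝ]) : Tensor d :=
  fun i => M (splitIndex d k i).2 (Fin.cast hk (splitIndex d k i).1)

theorem unfoldL_eq_iff {N : ℕ} {d : Fin N → ℕ} {K : ℕ} (k : Fin N) (hk : d k = K)
    (M : Matrix (Fin K) (Fin (codim d k)) ℍ[ℝ]) (T : Tensor d) :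
    unfoldL k hk T = M ↔ T = foldL k hk M := by
  subst hk
  constructor
  · rintro rfl
    funext i
    simp [unfoldL, foldL]
  · rintro rfl
    funext a c
    simp [unfoldL, foldL]

theorem unfoldR_eq_iff {N : ℕ} {d : Fin N → ℕ} {K : ℕ} (k : Fin N) (hk : d k = K)
    (M : Matrix (Fin (codim d k)) (Fin K) ℍ[ℝ]) (T : Tensor d) :
    unfoldR k hk T = M ↔ T = foldR k hk M := by
  subst hk
  constructor
  · rintro rfl
    funext i
    simp [unfoldR, foldR]
  · rintro rfl
    funext a c
    simp [unfoldR, foldR]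

/-! ### Left and right mode-`k` products -/

/-- The dimensions `e` are obtained from `d` by replacing the `k`-th one, `K`, by `J`. -/
structure ModeChange {N : ℕ} (d e : Fin N → ℕ) (k : Fin N) (K J : ℕ) : Prop where
  source : d k = K
  target : e k = J
  other : ∀ j, j ≠ k → e j = d j

/-- The multi-index `i` with its `k`-th component replaced by `a`. -/
def ModeChange.replace {N : ℕ} {d e : Fin N → ℕ} {k : Fin N} {K J : ℕ} (h : ModeChange d e k K J)
    (i : ∀ j, Fin (e j)) (a : Fin K) : ∀ j, Fin (d j) :=
  fun j => if hj : j = k then Fin.cast (by rw [hj, h.source]) a else Fin.cast (h.other j hj) (i j)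

/-- The left mode-`k` product `U ×ₖᴸ T`, with entries `∑_a u_{ja} t_{⋯a⋯}`. -/
def leftMul {N : ℕ} {d e : Fin N → ℕ} {k : Fin N} {K J : ℕ} (h : ModeChange d e k K J)
    (U : Matrix (Fin J) (Fin K) ℍ[ℝ]) (T : Tensor d) : Tensor e :=
  fun i => ∑ a, U (Fin.cast h.target (i k)) a * T (h.replace i a)

/-- The right mode-`k` product `T ×ₖᴿ V`, with entries `∑_a t_{⋯a⋯} v_{aj}`. -/
def rightMul {N : ℕ} {d e : Fin N → ℕ} {k : Fin N} {K J : ℕ} (h : ModeChange d e k K J)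
    (T : Tensor d) (V : Matrix (Fin K) (Fin J) ℍ[ℝ]) : Tensor e :=
  fun i => ∑ a, T (h.replace i a) * V a (Fin.cast h.target (i k))

theorem ModeChange.symm {N : ℕ} {d e : Fin N → ℕ} {k : Fin N} {K J : ℕ}
    (h : ModeChange d e k K J) : ModeChange e d k J K :=
  ⟨h.target, h.source, fun j hj => (h.other j hj).symm⟩

/-! ### Singular value decompositions -/

/-- The `p × q` matrix with the real numbers `σ 0, σ 1, …` on its main diagonal. -/
def rectDiag (p q : ℕ) (σ : ℕ → ℝ) : Matrix (Fin p) (Fin q) ℍ[ℝ] :=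
  fun i j => if (i : ℕ) = j then ((σ i : ℝ) : ℍ[ℝ]) else 0

/-- `A = U Σ Vᴴ` is a singular value decomposition of the `p × q` quaternion matrix `A`: `U` and `V`
are unitary and `Σ` is diagonal with the singular values of `A` in decreasing order, `σ i` being the
`(i + 1)`-st largest one; `σ i = 0` for `i ≥ min p q`. -/
structure IsSVD {p q : ℕ} (A : Matrix (Fin p) (Fin q) ℍ[ℝ]) (U : Matrix (Fin p) (Fin p) ℍ[ℝ])
    (σ : ℕ → ℝ) (V : Matrix (Fin q) (Fin q) ℍ[ℝ]) : Prop where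
  unitary_left : U ∈ unitary (Matrix (Fin p) (Fin p) ℍ[ℝ])
  unitary_right : V ∈ unitary (Matrix (Fin q) (Fin q) ℍ[ℝ])
  antitone : Antitone σ
  nonneg : ∀ i, 0 ≤ σ i
  eq_zero : ∀ i, min p q ≤ i → σ i = 0
  eq_mul : A = U * rectDiag p q σ * Vᴴ

/-- The embedding of the last `n - r` indices into `Fin n`. -/
def lastIdx {n r : ℕ} (h : r ≤ n) (i : Fin (n - r)) : Fin n := ⟨r + i, by omega⟩

/-- The first `r` columns of a matrix. -/
def headCols {p n r : ℕ} (h : r ≤ n) (U : Matrix (Fin p) (Fin n) ℍ[ℝ]) :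
    Matrix (Fin p) (Fin r) ℍ[ℝ] :=
  U.submatrix id (Fin.castLE h)

/-- The columns of a matrix after the first `r` ones. -/
def tailCols {p n r : ℕ} (h : r ≤ n) (U : Matrix (Fin p) (Fin n) ℍ[ℝ]) :
    Matrix (Fin p) (Fin (n - r)) ℍ[ℝ] :=
  U.submatrix id (lastIdx h)

/-- The rows of a matrix after the first `r` ones. -/
def tailRows {n q r : ℕ} (h : r ≤ n) (A : Matrix (Fin n) (Fin q) ℍ[ℝ]) :
    Matrix (Fin (n - r)) (Fin q) ℍ[ℝ] :=
  A.submatrix (lastIdx h) id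

/-- `Ũ Σ̃ Vᴴ`, where `Ũ` consists of the columns of `U` after the first `r` ones and `Σ̃` of the rows
of `Σ` after the first `r` ones. -/
def discardL {p q r : ℕ} (h : r ≤ p) (U : Matrix (Fin p) (Fin p) ℍ[ℝ]) (σ : ℕ → ℝ)
    (V : Matrix (Fin q) (Fin q) ℍ[ℝ]) : Matrix (Fin p) (Fin q) ℍ[ℝ] :=
  tailCols h U * tailRows h (rectDiag p q σ) * Vᴴ

/-- `U Σ̃ Ṽᴴ`, where `Σ̃` and `Ṽ` consist of the columns of `Σ` and `V` after the first `r` ones. -/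
def discardR {p q r : ℕ} (h : r ≤ q) (U : Matrix (Fin p) (Fin p) ℍ[ℝ]) (σ : ℕ → ℝ)
    (V : Matrix (Fin q) (Fin q) ℍ[ℝ]) : Matrix (Fin p) (Fin q) ℍ[ℝ] :=
  U * tailCols h (rectDiag p q σ) * (tailCols h V)ᴴ

/-! ### The truncation procedure for tensors of order `2 * m`

The steps are numbered `s = 0, …, m - 1`. Counting modes from `1`, step `s` treats the modes
`k = m - s` (from the left) and `2m - k + 1 = m + s + 1` (from the right). -/

section Procedure

variable {m : ℕ}

/-- The mode treated from the left in step `s`. -/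
def modeL (s : Fin m) : Fin (2 * m) := ⟨m - 1 - s, by omega⟩

/-- The mode treated from the right in step `s`. -/
def modeR (s : Fin m) : Fin (2 * m) := ⟨m + s, by omega⟩

/-- The dimensions after truncation of the last `a` of the first `m` modes and of the first `b` of
the last `m` modes, where truncation replaces the dimension `I j` by `r j`. -/
def dims (I r : Fin (2 * m) → ℕ) (a b : ℕ) : Fin (2 * m) → ℕ :=
  fun j => if m ≤ (j : ℕ) + a ∧ (j : ℕ) < m + b then r j else I j

theorem dims_zero (I r : Fin (2 * m) → ℕ) (j : Fin (2 * m)) : dims I r 0 0 j = I j := by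
  unfold dims
  rw [if_neg (by omega)]

theorem modeChangeL (I r : Fin (2 * m) → ℕ) (s : Fin m) (b : ℕ) :
    ModeChange (dims I r s b) (dims I r (s + 1) b) (modeL s) (I (modeL s)) (r (modeL s)) where
  source := by
    unfold dims
    rw [if_neg (by simp only [modeL]; omega)]
  target := by
    unfold dims
    rw [if_pos (by simp only [modeL]; omega)]
  other j hj := by
    have : (j : ℕ) ≠ m - 1 - s := fun h => hj (Fin.ext h)
    unfold dims
    congr 1
    apply propext
    omega

theorem modeChangeR (I r : Fin (2 * m) → ℕ) (s : Fin m) (a : ℕ) :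
    ModeChange (dims I r a s) (dims I r a (s + 1)) (modeR s) (I (modeR s)) (r (modeR s)) where
  source := by
    unfold dims
    rw [if_neg (by simp only [modeR]; omega)]
  target := by
    unfold dims
    rw [if_pos (by simp only [modeR]; omega)]
  other j hj := by
    have : (j : ℕ) ≠ m + s := fun h => hj (Fin.ext h)
    unfold dims
    congr 1
    apply propext
    omega

/-- The tensor after the first `s` steps: step `s` replaces the current tensor `X` by
`Ûᴴ ×ᴸ X ×ᴿ V̂`, where `Û`, `V̂` are the truncated factors of that step. -/
def stage {I r : Fin (2 * m) → ℕ} (T : Tensor I)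
    (Uhat : ∀ s : Fin m, Matrix (Fin (I (modeL s))) (Fin (r (modeL s))) ℍ[ℝ])
    (Vhat : ∀ s : Fin m, Matrix (Fin (I (modeR s))) (Fin (r (modeR s))) ℍ[ℝ]) :
    (s : ℕ) → s ≤ m → Tensor (dims I r s s)
  | 0, _ => T.castDims (dims_zero I r)
  | s + 1, hs =>
    rightMul (modeChangeR I r ⟨s, hs⟩ (s + 1))
      (leftMul (modeChangeL I r ⟨s, hs⟩ s) (Uhat ⟨s, hs⟩)ᴴ (stage T Uhat Vhat s (by omega)))
      (Vhat ⟨s, hs⟩)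

/-- `Û_m ×_mᴸ ⋯ Û_{m-a+1} ×_{m-a+1}ᴸ X`. -/
def expandL {I r : Fin (2 * m) → ℕ}
    (Uhat : ∀ s : Fin m, Matrix (Fin (I (modeL s))) (Fin (r (modeL s))) ℍ[ℝ]) {b : ℕ} :
    (a : ℕ) → a ≤ m → Tensor (dims I r a b) → Tensor (dims I r 0 b)
  | 0, _, X => X
  | a + 1, ha, X =>
    expandL Uhat a (by omega) (leftMul (modeChangeL I r ⟨a, ha⟩ b).symm (Uhat ⟨a, ha⟩) X)

/-- `X ×_{m+b}ᴿ V̂_{m+b}ᴴ ⋯ ×_{m+1}ᴿ V̂_{m+1}ᴴ`. -/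
def expandR {I r : Fin (2 * m) → ℕ}
    (Vhat : ∀ s : Fin m, Matrix (Fin (I (modeR s))) (Fin (r (modeR s))) ℍ[ℝ]) {a : ℕ} :
    (b : ℕ) → b ≤ m → Tensor (dims I r a b) → Tensor (dims I r a 0)
  | 0, _, X => X
  | b + 1, hb, X =>
    expandR Vhat b (by omega) (rightMul (modeChangeR I r ⟨b, hb⟩ a).symm X (Vhat ⟨b, hb⟩)ᴴ)

end Procedure

/-- A rank-`(r 0, …, r (2m - 1))` truncated two-sided quaternion HOSVD of `T`, as a record of all
choices made by the procedure: in step `s`, singular value decompositions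
`X^L_[k] = U Σᴸ Pᴴ` and `X^R_[k'] = Q Σᴿ Vᴴ` of the unfoldings of the current tensor `X`, from which
`Û` and `V̂` are obtained by keeping the leading `r k` columns of `U` and `r k'` columns of `V`. -/
structure TruncatedDecomposition {m : ℕ} {I : Fin (2 * m) → ℕ} (T : Tensor I)
    (r : Fin (2 * m) → ℕ) (hr : ∀ k, r k ≤ I k) where
  U : ∀ s : Fin m, Matrix (Fin (I (modeL s))) (Fin (I (modeL s))) ℍ[ℝ]
  σL : Fin m → ℕ → ℝ
  P : ∀ s : Fin m, Matrix (Fin (codim (dims I r s s) (modeL s)))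
    (Fin (codim (dims I r s s) (modeL s))) ℍ[ℝ]
  Q : ∀ s : Fin m, Matrix (Fin (codim (dims I r s s) (modeR s)))
    (Fin (codim (dims I r s s) (modeR s))) ℍ[ℝ]
  σR : Fin m → ℕ → ℝ
  V : ∀ s : Fin m, Matrix (Fin (I (modeR s))) (Fin (I (modeR s))) ℍ[ℝ]
  svdL : ∀ s : Fin m,
    IsSVD
      (unfoldL (modeL s) (modeChangeL I r s s).source
        (stage T (fun t => headCols (hr (modeL t)) (U t)) (fun t => headCols (hr (modeR t)) (V t))
          s s.2.le))
      (U s) (σL s) (P s)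
  svdR : ∀ s : Fin m,
    IsSVD
      (unfoldR (modeR s) (modeChangeR I r s s).source
        (stage T (fun t => headCols (hr (modeL t)) (U t)) (fun t => headCols (hr (modeR t)) (V t))
          s s.2.le))
      (Q s) (σR s) (V s)

namespace TruncatedDecomposition

variable {m : ℕ} {I : Fin (2 * m) → ℕ} {T : Tensor I} {r : Fin (2 * m) → ℕ} {hr : ∀ k, r k ≤ I k}

/-- The truncated left factor `Û` of step `s`. -/
def Uhat (D : TruncatedDecomposition T r hr) (s : Fin m) :
    Matrix (Fin (I (modeL s))) (Fin (r (modeL s))) ℍ[ℝ] := headCols (hr (modeL s)) (D.U s)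

/-- The truncated right factor `V̂` of step `s`. -/
def Vhat (D : TruncatedDecomposition T r hr) (s : Fin m) :
    Matrix (Fin (I (modeR s))) (Fin (r (modeR s))) ℍ[ℝ] := headCols (hr (modeR s)) (D.V s)

/-- The truncated core tensor `Ŝ = Û₁ᴴ ×₁ᴸ ⋯ Û_mᴴ ×_mᴸ T ×_{m+1}ᴿ V̂_{m+1} ⋯ ×_Nᴿ V̂_N`. -/
def core (D : TruncatedDecomposition T r hr) : Tensor (dims I r m m) :=
  stage T D.Uhat D.Vhat m le_rfl

/-- The reconstruction
`T̂ = Û_m ×_mᴸ ⋯ Û₁ ×₁ᴸ Ŝ ×_Nᴿ V̂_Nᴴ ⋯ ×_{m+1}ᴿ V̂_{m+1}ᴴ`. -/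
def approx (D : TruncatedDecomposition T r hr) : Tensor I :=
  (expandR D.Vhat m le_rfl (expandL D.Uhat m le_rfl D.core)).castDims
    fun j => (dims_zero I r j).symm

/-- The left residual tensor of step `s`: its left unfolding is `Ũ Σ̃ᴸ Pᴴ`, where `Ũ` and `Σ̃ᴸ` are
the discarded columns of `U` and rows of `Σᴸ`. -/
def resL (D : TruncatedDecomposition T r hr) (s : Fin m) : Tensor (dims I r s s) :=
  foldL (modeL s) (modeChangeL I r s s).source
    (discardL (hr (modeL s)) (D.U s) (D.σL s) (D.P s))

/-- The right residual tensor of step `s`: its right unfolding is `Q Σ̃ᴿ Ṽᴴ`, where `Ṽ` and `Σ̃ᴿ` are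
the discarded columns of `V` and of `Σᴿ`. -/
def resR (D : TruncatedDecomposition T r hr) (s : Fin m) : Tensor (dims I r s s) :=
  foldR (modeR s) (modeChangeR I r s s).source
    (discardR (hr (modeR s)) (D.Q s) (D.σR s) (D.V s))

end TruncatedDecomposition

end TSQHOSVD

end

/-!
The reconstruction is the orthogonal projection of `T` onto the range of an isometry, so the squared
error is a difference of squared norms, and that difference telescopes over the steps.

Tensors carry the real inner product `tensorInner`, whose squared norm is `frobNorm ^ 2`. For it the
adjoint of a left (right) mode product with `U` is the left (right) mode product with `Uᴴ`
(`tensorInner_leftMul`, `tensorInner_rightMul`); the latter uses that the real part of a product of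
quaternions is cyclic. Left products commute with right products along other modes
(`rightMul_leftMul`) because quaternion multiplication is associative, whereas products on the same
side do not commute. This is enough to see that expanding a core is the adjoint of the truncation
procedure (`tensorInner_stage`): a left and a right product have to be exchanged, never two products
on the same side. Expansion is isometric (`frobNorm_expandL_sq`, `frobNorm_expandR_sq`), whence
`‖T - T̂‖² = ‖T‖² - ‖Ŝ‖²` (`frobNorm_sub_expand_sq`).

In one step, with current tensor `X`, the singular value decompositions identify the residuals as
`X - Û Ûᴴ X` and `X - X V̂ V̂ᴴ` (`TruncatedDecomposition.resL_eq`, `TruncatedDecomposition.resR_eq`).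
Passing from `X` to `Ûᴴ X V̂` through `Ûᴴ X`, or through `X V̂`, and using Pythagoras twice gives the
two formulas for the loss in one step. The inequality holds because a mode product with `Ûᴴ` does not
increase the norm, while `‖E^L‖` and `‖E^R‖` are the norms of the discarded parts of `Σ`
(`frobNorm_resL_sq`, `frobNorm_resR_sq`).
-/

open scoped Quaternion Matrix

namespace TSQHOSVD

/-! ### Matrices with orthonormal columns -/

theorem sum_head_add_sum_tail {M : Type*} [AddCommMonoid M] {n r : ℕ} (h : r ≤ n) (f : Fin n → M) :
    ∑ i : Fin r, f (Fin.castLE h i) + ∑ i : Fin (n - r), f (lastIdx h i) = ∑ i, f i := by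
  rw [← Equiv.sum_comp (finCongr (show r + (n - r) = n by omega)) f, Fin.sum_univ_add]
  rfl

theorem headCols_mul_add_tailCols_mul {p n q r : ℕ} (h : r ≤ n) (U : Matrix (Fin p) (Fin n) ℍ[ℝ])
    (W : Matrix (Fin q) (Fin n) ℍ[ℝ]) :
    headCols h U * (headCols h W)ᴴ + tailCols h U * (tailCols h W)ᴴ = U * Wᴴ := by
  ext1 i j
  simp only [Matrix.add_apply, Matrix.mul_apply]
  exact sum_head_add_sum_tail h fun l => U i l * Wᴴ l j

theorem headCols_conjTranspose_mul_self {p n r : ℕ} (h : r ≤ n) {U : Matrix (Fin p) (Fin n) ℍ[ℝ]}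
    (hU : Uᴴ * U = 1) : (headCols h U)ᴴ * headCols h U = 1 := by
  have : (headCols h U)ᴴ * headCols h U = (Uᴴ * U).submatrix (Fin.castLE h) (Fin.castLE h) := rfl
  rw [this, hU, Matrix.submatrix_one _ (Fin.castLE_injective h)]

theorem lastIdx_injective {n r : ℕ} (h : r ≤ n) : Function.Injective (lastIdx h) := by
  intro i j hij
  have := congrArg Fin.val hij
  simp only [lastIdx] at this
  exact Fin.ext (by omega)

theorem tailCols_conjTranspose_mul_self {p n r : ℕ} (h : r ≤ n) {U : Matrix (Fin p) (Fin n) ℍ[ℝ]}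
    (hU : Uᴴ * U = 1) : (tailCols h U)ᴴ * tailCols h U = 1 := by
  have : (tailCols h U)ᴴ * tailCols h U = (Uᴴ * U).submatrix (lastIdx h) (lastIdx h) := rfl
  rw [this, hU, Matrix.submatrix_one _ (lastIdx_injective h)]

/-! ### Discarded parts of a singular value decomposition -/

section SVD

variable {p q r : ℕ} {A : Matrix (Fin p) (Fin q) ℍ[ℝ]} {U : Matrix (Fin p) (Fin p) ℍ[ℝ]}
  {σ : ℕ → ℝ} {V : Matrix (Fin q) (Fin q) ℍ[ℝ]}

theorem IsSVD.conjTranspose_mul_left (hA : IsSVD A U σ V) : Uᴴ * U = 1 :=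
  Unitary.star_mul_self_of_mem hA.unitary_left

theorem IsSVD.mul_conjTranspose_left (hA : IsSVD A U σ V) : U * Uᴴ = 1 :=
  Unitary.mul_star_self_of_mem hA.unitary_left

theorem IsSVD.conjTranspose_mul_right (hA : IsSVD A U σ V) : Vᴴ * V = 1 :=
  Unitary.star_mul_self_of_mem hA.unitary_right

theorem IsSVD.mul_conjTranspose_right (hA : IsSVD A U σ V) : V * Vᴴ = 1 :=
  Unitary.mul_star_self_of_mem hA.unitary_right

theorem IsSVD.discardL_eq (hA : IsSVD A U σ V) (h : r ≤ p) :
    discardL h U σ V = (1 - headCols h U * (headCols h U)ᴴ) * A := by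
  -- `Ũᴴ U` consists of the last rows of the identity, so it selects the last rows of `Σ`.
  have htail : (tailCols h U)ᴴ * U * rectDiag p q σ = tailRows h (rectDiag p q σ) := by
    have : (tailCols h U)ᴴ * U = (Uᴴ * U).submatrix (lastIdx h) id := rfl
    rw [this, hA.conjTranspose_mul_left]
    have : (1 : Matrix (Fin p) (Fin p) ℍ[ℝ]).submatrix (lastIdx h) id * rectDiag p q σ =
        ((1 : Matrix (Fin p) (Fin p) ℍ[ℝ]) * rectDiag p q σ).submatrix (lastIdx h) id := rfl
    rw [this, Matrix.one_mul]
    rfl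
  have hproj : 1 - headCols h U * (headCols h U)ᴴ = tailCols h U * (tailCols h U)ᴴ := by
    rw [← hA.mul_conjTranspose_left, ← headCols_mul_add_tailCols_mul h U U, add_sub_cancel_left]
  rw [hproj, discardL, ← htail, hA.eq_mul]
  simp only [Matrix.mul_assoc]

theorem IsSVD.discardR_eq (hA : IsSVD A U σ V) (h : r ≤ q) :
    discardR h U σ V = A * (1 - headCols h V * (headCols h V)ᴴ) := by
  have htail : rectDiag p q σ * (Vᴴ * tailCols h V) = tailCols h (rectDiag p q σ) := by
    have : Vᴴ * tailCols h V = (Vᴴ * V).submatrix id (lastIdx h) := rfl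
    rw [this, hA.conjTranspose_mul_right]
    have : rectDiag p q σ * (1 : Matrix (Fin q) (Fin q) ℍ[ℝ]).submatrix id (lastIdx h) =
        (rectDiag p q σ * (1 : Matrix (Fin q) (Fin q) ℍ[ℝ])).submatrix id (lastIdx h) := rfl
    rw [this, Matrix.mul_one]
    rfl
  have hproj : 1 - headCols h V * (headCols h V)ᴴ = tailCols h V * (tailCols h V)ᴴ := by
    rw [← hA.mul_conjTranspose_right, ← headCols_mul_add_tailCols_mul h V V, add_sub_cancel_left]
  rw [hproj, discardR, ← htail, hA.eq_mul]
  simp only [Matrix.mul_assoc]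

/-- The squared Frobenius norm of a quaternion matrix. -/
noncomputable def matrixNormSq {p q : ℕ} (A : Matrix (Fin p) (Fin q) ℍ[ℝ]) : ℝ := ∑ i, ∑ j, ‖A i j‖ ^ 2

theorem re_star_mul_self_eq (a : ℍ[ℝ]) : (star a * a).re = ‖a‖ ^ 2 := by
  rw [Quaternion.star_mul_self, Quaternion.re_coe, Quaternion.normSq_eq_norm_mul_self, sq]

theorem re_mul_star_self_eq (a : ℍ[ℝ]) : (a * star a).re = ‖a‖ ^ 2 := by
  rw [Quaternion.self_mul_star, Quaternion.re_coe, Quaternion.normSq_eq_norm_mul_self, sq]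

theorem re_sum {ι : Type*} (s : Finset ι) (f : ι → ℍ[ℝ]) :
    (∑ i ∈ s, f i).re = ∑ i ∈ s, (f i).re := by
  classical
  induction s using Finset.induction_on with
  | empty => simp
  | insert a s ha ih => rw [Finset.sum_insert ha, Finset.sum_insert ha, Quaternion.re_add, ih]

theorem matrixNormSq_eq_sum_conjTranspose_mul {p q : ℕ} (A : Matrix (Fin p) (Fin q) ℍ[ℝ]) :
    matrixNormSq A = ∑ j, ((Aᴴ * A) j j).re := by
  simp only [matrixNormSq, Matrix.mul_apply, Matrix.conjTranspose_apply, re_sum,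
    re_star_mul_self_eq]
  exact Finset.sum_comm

theorem matrixNormSq_eq_sum_mul_conjTranspose {p q : ℕ} (A : Matrix (Fin p) (Fin q) ℍ[ℝ]) :
    matrixNormSq A = ∑ i, ((A * Aᴴ) i i).re := by
  simp only [matrixNormSq, Matrix.mul_apply, Matrix.conjTranspose_apply, re_sum,
    re_mul_star_self_eq]

theorem matrixNormSq_mul_left {n p q : ℕ} {U : Matrix (Fin n) (Fin p) ℍ[ℝ]} (hU : Uᴴ * U = 1)
    (A : Matrix (Fin p) (Fin q) ℍ[ℝ]) : matrixNormSq (U * A) = matrixNormSq A := by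
  have : (U * A)ᴴ * (U * A) = Aᴴ * A := by
    rw [Matrix.conjTranspose_mul, Matrix.mul_assoc, ← Matrix.mul_assoc Uᴴ, hU, Matrix.one_mul]
  rw [matrixNormSq_eq_sum_conjTranspose_mul, this, ← matrixNormSq_eq_sum_conjTranspose_mul]

theorem matrixNormSq_mul_right {n p q : ℕ} {V : Matrix (Fin n) (Fin q) ℍ[ℝ]} (hV : Vᴴ * V = 1)
    (A : Matrix (Fin p) (Fin q) ℍ[ℝ]) : matrixNormSq (A * Vᴴ) = matrixNormSq A := by
  have : (A * Vᴴ) * (A * Vᴴ)ᴴ = A * Aᴴ := by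
    rw [Matrix.conjTranspose_mul, Matrix.conjTranspose_conjTranspose, Matrix.mul_assoc,
      ← Matrix.mul_assoc Vᴴ, hV, Matrix.one_mul]
  rw [matrixNormSq_eq_sum_mul_conjTranspose, this, ← matrixNormSq_eq_sum_mul_conjTranspose]

theorem sum_norm_rectDiag_row (hσ : ∀ i, min p q ≤ i → σ i = 0) (i : Fin p) :
    ∑ j, ‖rectDiag p q σ i j‖ ^ 2 = σ i ^ 2 := by
  have hterm (j : Fin q) : ‖rectDiag p q σ i j‖ ^ 2 = if (i : ℕ) = j then σ i ^ 2 else 0 := by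
    by_cases hij : (i : ℕ) = j <;> simp [rectDiag, hij]
  simp only [hterm]
  by_cases hi : (i : ℕ) < q
  · rw [Finset.sum_eq_single ⟨i, hi⟩ (fun j _ hj => if_neg fun e => hj (Fin.ext e.symm))
      (by simp), if_pos rfl]
  · rw [hσ i (by omega)]
    simp

theorem sum_norm_rectDiag_col (hσ : ∀ i, min p q ≤ i → σ i = 0) (j : Fin q) :
    ∑ i, ‖rectDiag p q σ i j‖ ^ 2 = σ j ^ 2 := by
  have hterm (i : Fin p) : ‖rectDiag p q σ i j‖ ^ 2 = if (i : ℕ) = j then σ j ^ 2 else 0 := by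
    by_cases hij : (i : ℕ) = j <;> simp [rectDiag, hij]
  simp only [hterm]
  by_cases hj : (j : ℕ) < p
  · rw [Finset.sum_eq_single ⟨j, hj⟩ (fun i _ hi => if_neg fun e => hi (Fin.ext e))
      (by simp), if_pos rfl]
  · rw [hσ j (by omega)]
    simp

theorem sum_lastIdx {n r : ℕ} (h : r ≤ n) (f : ℕ → ℝ) :
    ∑ i : Fin (n - r), f (lastIdx h i) = ∑ i ∈ Finset.Ico r n, f i := by
  rw [Finset.sum_Ico_eq_sum_range, ← Fin.sum_univ_eq_sum_range (fun i => f (r + i))]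
  rfl

theorem IsSVD.matrixNormSq_discardL (hA : IsSVD A U σ V) (h : r ≤ p) :
    matrixNormSq (discardL h U σ V) = ∑ i ∈ Finset.Ico r p, σ i ^ 2 := by
  rw [discardL, matrixNormSq_mul_right hA.conjTranspose_mul_right,
    matrixNormSq_mul_left (tailCols_conjTranspose_mul_self h hA.conjTranspose_mul_left),
    ← sum_lastIdx h]
  exact Finset.sum_congr rfl fun i _ => sum_norm_rectDiag_row hA.eq_zero (lastIdx h i)

theorem IsSVD.matrixNormSq_discardR (hA : IsSVD A U σ V) (h : r ≤ q) :
    matrixNormSq (discardR h U σ V) = ∑ i ∈ Finset.Ico r q, σ i ^ 2 := by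
  rw [discardR, matrixNormSq_mul_right
      (tailCols_conjTranspose_mul_self h hA.conjTranspose_mul_right),
    matrixNormSq_mul_left hA.conjTranspose_mul_left, ← sum_lastIdx h, matrixNormSq,
    Finset.sum_comm]
  exact Finset.sum_congr rfl fun j _ => sum_norm_rectDiag_col hA.eq_zero (lastIdx h j)

end SVD

/-! ### The real inner product of tensors -/

section Inner

variable {N : ℕ} {d : Fin N → ℕ}

/-- The real inner product `∑ Re (aᵢ b̄ᵢ)` of quaternion tensors. -/
noncomputable def tensorInner (A B : Tensor d) : ℝ := ∑ i, inner ℝ (A i) (B i)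

theorem frobNorm_sq (A : Tensor d) : frobNorm A ^ 2 = ∑ i, ‖A i‖ ^ 2 :=
  Real.sq_sqrt (Finset.sum_nonneg fun _ _ => sq_nonneg _)

theorem tensorInner_self (A : Tensor d) : tensorInner A A = frobNorm A ^ 2 := by
  simp only [frobNorm_sq, tensorInner, real_inner_self_eq_norm_sq]

/-- If `B` is the orthogonal projection of `A` onto a subspace, then `‖A - B‖² = ‖A‖² - ‖B‖²`. -/
theorem frobNorm_sub_sq {A B : Tensor d} (h : tensorInner A B = frobNorm B ^ 2) :
    frobNorm (A - B) ^ 2 = frobNorm A ^ 2 - frobNorm B ^ 2 := by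
  have key : frobNorm (A - B) ^ 2 = frobNorm A ^ 2 - 2 * tensorInner A B + frobNorm B ^ 2 := by
    simp only [frobNorm_sq, tensorInner, Finset.mul_sum, ← Finset.sum_sub_distrib,
      ← Finset.sum_add_distrib, Pi.sub_apply, norm_sub_sq_real]
  rw [key, h]
  ring

theorem frobNorm_sub_castDims {e : Fin N → ℕ} (h : ∀ j, e j = d j) (h' : ∀ j, d j = e j)
    (A : Tensor d) (B : Tensor e) :
    frobNorm (A - B.castDims h') = frobNorm (A.castDims h - B) := by
  obtain rfl : e = d := funext h
  rfl

theorem inner_mul_left_quaternion (u a b : ℍ[ℝ]) :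
    inner ℝ (u * a) b = inner ℝ a (star u * b) := by
  simp only [Quaternion.inner_def, star_mul, star_star, Quaternion.re_mul, Quaternion.imI_mul,
    Quaternion.imJ_mul, Quaternion.imK_mul]
  ring

theorem inner_mul_right_quaternion (a v b : ℍ[ℝ]) :
    inner ℝ (a * v) b = inner ℝ a (b * star v) := by
  rw [Quaternion.inner_def, Quaternion.inner_def, star_mul, star_star, mul_assoc]

end Inner

/-! ### Mode products -/

section ModeProducts

variable {N : ℕ} {d e f g : Fin N → ℕ} {k l : Fin N} {K J L : ℕ}

theorem ModeChange.replace_self (h : ModeChange d e k K J) (i : ∀ j, Fin (e j)) (a : Fin K) :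
    h.replace i a k = Fin.cast h.source.symm a := by
  simp [ModeChange.replace]

theorem ModeChange.replace_of_ne (h : ModeChange d e k K J) (i : ∀ j, Fin (e j)) (a : Fin K)
    {j : Fin N} (hj : j ≠ k) : h.replace i a j = Fin.cast (h.other j hj) (i j) := by
  simp [ModeChange.replace, hj]

theorem ModeChange.replace_replace (h : ModeChange d e k K J) (h' : ModeChange e f k J L)
    (h'' : ModeChange d f k K L) (i : ∀ j, Fin (f j)) (b : Fin J) (a : Fin K) :
    h.replace (h'.replace i b) a = h''.replace i a := by
  funext j
  by_cases hj : j = k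
  · subst hj
    simp only [replace_self]
  · simp only [replace_of_ne _ _ _ hj, Fin.cast_cast]

theorem ModeChange.replace_eq_self (h : ModeChange d d k K K) (i : ∀ j, Fin (d j)) :
    h.replace i (Fin.cast h.target (i k)) = i := by
  funext j
  by_cases hj : j = k
  · subst hj
    simp only [replace_self, Fin.cast_cast, Fin.cast_eq_self]
  · simp only [replace_of_ne _ _ _ hj, Fin.cast_eq_self]

theorem ModeChange.replace_comm {K' J' : ℕ} (hkl : k ≠ l) (h₁ : ModeChange d e k K J)
    (h₂ : ModeChange e g l K' J') (h₃ : ModeChange d f l K' J') (h₄ : ModeChange f g k K J)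
    (i : ∀ j, Fin (g j)) (a : Fin K) (b : Fin K') :
    h₁.replace (h₂.replace i b) a = h₃.replace (h₄.replace i a) b := by
  funext j
  by_cases hj : j = k
  · subst hj
    simp only [replace_self, replace_of_ne _ _ _ hkl, Fin.cast_cast]
  · by_cases hj' : j = l
    · subst hj'
      simp only [replace_self, replace_of_ne _ _ _ hj, Fin.cast_cast]
    · simp only [replace_of_ne _ _ _ hj, replace_of_ne _ _ _ hj', Fin.cast_cast]

theorem ModeChange.refl (hk : d k = K) : ModeChange d d k K K := ⟨hk, hk, fun _ _ => rfl⟩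

/-- The exchange of a replaced component with its replacement. -/
def ModeChange.swap (h : ModeChange d e k K J) :
    (∀ j, Fin (e j)) × Fin K ≃ (∀ j, Fin (d j)) × Fin J where
  toFun x := (h.replace x.1 x.2, Fin.cast h.target (x.1 k))
  invFun y := (h.symm.replace y.1 y.2, Fin.cast h.source (y.1 k))
  left_inv := by
    rintro ⟨i, a⟩
    refine Prod.ext ?_ ?_
    · exact (h.symm.replace_replace h (.refl h.target) _ _ _).trans
        (ModeChange.replace_eq_self _ _)
    · simp [h.replace_self]
  right_inv := by
    rintro ⟨i, a⟩
    refine Prod.ext ?_ ?_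
    · exact (h.replace_replace h.symm (.refl h.source) _ _ _).trans
        (ModeChange.replace_eq_self _ _)
    · simp [h.symm.replace_self]

theorem sum_replace (h : ModeChange d e k K J) (F : (∀ j, Fin (d j)) → (∀ j, Fin (e j)) → ℝ) :
    ∑ i, ∑ a, F (h.replace i a) i = ∑ i, ∑ b, F i (h.symm.replace i b) := by
  rw [← Fintype.sum_prod_type', ← Fintype.sum_prod_type',
    ← Equiv.sum_comp h.swap fun y : (∀ j, Fin (d j)) × Fin J => F y.1 (h.symm.replace y.1 y.2)]
  refine Finset.sum_congr rfl fun x _ => ?_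
  congr 1
  exact (congrArg Prod.fst (h.swap.left_inv x)).symm

/-- The left mode product with `Uᴴ` is the adjoint of the left mode product with `U`. -/
theorem tensorInner_leftMul (h : ModeChange d e k K J) (U : Matrix (Fin J) (Fin K) ℍ[ℝ])
    (A : Tensor d) (B : Tensor e) :
    tensorInner (leftMul h U A) B = tensorInner A (leftMul h.symm Uᴴ B) := by
  have key := sum_replace h fun i' i =>
    inner ℝ (U (Fin.cast h.target (i k)) (Fin.cast h.source (i' k)) * A i') (B i)
  simp only [ModeChange.replace_self, Fin.cast_cast, Fin.cast_eq_self] at key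
  simp only [tensorInner, leftMul, sum_inner, inner_sum, Matrix.conjTranspose_apply,
    ← inner_mul_left_quaternion]
  exact key

/-- The right mode product with `Vᴴ` is the adjoint of the right mode product with `V`. -/
theorem tensorInner_rightMul (h : ModeChange d e k K J) (V : Matrix (Fin K) (Fin J) ℍ[ℝ])
    (A : Tensor d) (B : Tensor e) :
    tensorInner (rightMul h A V) B = tensorInner A (rightMul h.symm B Vᴴ) := by
  have key := sum_replace h fun i' i =>
    inner ℝ (A i' * V (Fin.cast h.source (i' k)) (Fin.cast h.target (i k))) (B i)
  simp only [ModeChange.replace_self, Fin.cast_cast, Fin.cast_eq_self] at key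
  simp only [tensorInner, rightMul, sum_inner, inner_sum, Matrix.conjTranspose_apply,
    ← inner_mul_right_quaternion]
  exact key

theorem leftMul_leftMul (h : ModeChange d e k K J) (h' : ModeChange e f k J L)
    (h'' : ModeChange d f k K L) (W : Matrix (Fin L) (Fin J) ℍ[ℝ])
    (U : Matrix (Fin J) (Fin K) ℍ[ℝ]) (A : Tensor d) :
    leftMul h' W (leftMul h U A) = leftMul h'' (W * U) A := by
  funext i
  simp only [leftMul, Matrix.mul_apply, Finset.mul_sum, Finset.sum_mul,
    h.replace_replace h' h'', ModeChange.replace_self, Fin.cast_cast, Fin.cast_eq_self, mul_assoc]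
  exact Finset.sum_comm

theorem rightMul_rightMul (h : ModeChange d e k K J) (h' : ModeChange e f k J L)
    (h'' : ModeChange d f k K L) (V : Matrix (Fin K) (Fin J) ℍ[ℝ])
    (W : Matrix (Fin J) (Fin L) ℍ[ℝ]) (A : Tensor d) :
    rightMul h' (rightMul h A V) W = rightMul h'' A (V * W) := by
  funext i
  simp only [rightMul, Matrix.mul_apply, Finset.mul_sum, Finset.sum_mul,
    h.replace_replace h' h'', ModeChange.replace_self, Fin.cast_cast, Fin.cast_eq_self, mul_assoc]
  exact Finset.sum_comm

theorem leftMul_one (h : ModeChange d d k K K) (A : Tensor d) : leftMul h 1 A = A := by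
  funext i
  simp [leftMul, Matrix.one_apply, h.replace_eq_self]

theorem rightMul_one (h : ModeChange d d k K K) (A : Tensor d) : rightMul h A 1 = A := by
  funext i
  simp [rightMul, Matrix.one_apply, h.replace_eq_self]

theorem leftMul_sub (h : ModeChange d e k K J) (U : Matrix (Fin J) (Fin K) ℍ[ℝ])
    (A B : Tensor d) : leftMul h U (A - B) = leftMul h U A - leftMul h U B := by
  funext i
  simp [leftMul, mul_sub]

theorem sub_leftMul (h : ModeChange d e k K J) (U W : Matrix (Fin J) (Fin K) ℍ[ℝ])
    (A : Tensor d) : leftMul h (U - W) A = leftMul h U A - leftMul h W A := by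
  funext i
  simp [leftMul, sub_mul]

theorem sub_rightMul (h : ModeChange d e k K J) (A B : Tensor d)
    (V : Matrix (Fin K) (Fin J) ℍ[ℝ]) :
    rightMul h (A - B) V = rightMul h A V - rightMul h B V := by
  funext i
  simp [rightMul, sub_mul]

theorem rightMul_sub (h : ModeChange d e k K J) (A : Tensor d)
    (V W : Matrix (Fin K) (Fin J) ℍ[ℝ]) :
    rightMul h A (V - W) = rightMul h A V - rightMul h A W := by
  funext i
  simp [rightMul, mul_sub]

/-- Left and right products along different modes commute. -/
theorem rightMul_leftMul {K' J' : ℕ} (hkl : k ≠ l) (h₁ : ModeChange d e k K J)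
    (h₂ : ModeChange e g l K' J') (h₃ : ModeChange d f l K' J') (h₄ : ModeChange f g k K J)
    (U : Matrix (Fin J) (Fin K) ℍ[ℝ]) (A : Tensor d) (V : Matrix (Fin K') (Fin J') ℍ[ℝ]) :
    rightMul h₂ (leftMul h₁ U A) V = leftMul h₄ U (rightMul h₃ A V) := by
  funext i
  simp only [leftMul, rightMul, Finset.mul_sum, Finset.sum_mul,
    ModeChange.replace_of_ne _ _ _ hkl, ModeChange.replace_of_ne _ _ _ hkl.symm, Fin.cast_cast,
    h₁.replace_comm hkl h₂ h₃ h₄, mul_assoc]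
  exact Finset.sum_comm

/-! ### Orthogonal projections along a mode -/

theorem frobNorm_leftMul_sq (h : ModeChange d e k K J) {U : Matrix (Fin J) (Fin K) ℍ[ℝ]}
    (hU : Uᴴ * U = 1) (A : Tensor d) : frobNorm (leftMul h U A) ^ 2 = frobNorm A ^ 2 := by
  rw [← tensorInner_self, tensorInner_leftMul, leftMul_leftMul h h.symm (.refl h.source), hU,
    leftMul_one, tensorInner_self]

theorem frobNorm_rightMul_sq (h : ModeChange d e k K J) {V : Matrix (Fin J) (Fin K) ℍ[ℝ]}
    (hV : Vᴴ * V = 1) (A : Tensor d) : frobNorm (rightMul h A Vᴴ) ^ 2 = frobNorm A ^ 2 := by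
  rw [← tensorInner_self, tensorInner_rightMul, rightMul_rightMul h h.symm (.refl h.source),
    Matrix.conjTranspose_conjTranspose, hV, rightMul_one, tensorInner_self]

theorem frobNorm_sub_leftMul_leftMul_sq (h : ModeChange d e k K J)
    {U : Matrix (Fin K) (Fin J) ℍ[ℝ]} (hU : Uᴴ * U = 1) (A : Tensor d) :
    frobNorm (A - leftMul h.symm U (leftMul h Uᴴ A)) ^ 2 =
      frobNorm A ^ 2 - frobNorm (leftMul h Uᴴ A) ^ 2 := by
  have key := tensorInner_leftMul h Uᴴ A (leftMul h Uᴴ A)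
  rw [Matrix.conjTranspose_conjTranspose, tensorInner_self] at key
  rw [frobNorm_sub_sq (key.symm.trans (frobNorm_leftMul_sq h.symm hU _).symm),
    frobNorm_leftMul_sq h.symm hU]

theorem frobNorm_sub_rightMul_rightMul_sq (h : ModeChange d e k K J)
    {V : Matrix (Fin K) (Fin J) ℍ[ℝ]} (hV : Vᴴ * V = 1) (A : Tensor d) :
    frobNorm (A - rightMul h.symm (rightMul h A V) Vᴴ) ^ 2 =
      frobNorm A ^ 2 - frobNorm (rightMul h A V) ^ 2 := by
  have key := tensorInner_rightMul h V A (rightMul h A V)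
  rw [tensorInner_self] at key
  rw [frobNorm_sub_sq (key.symm.trans (frobNorm_rightMul_sq h.symm hV _).symm),
    frobNorm_rightMul_sq h.symm hV]

theorem frobNorm_leftMul_conjTranspose_sq_le (h : ModeChange d e k K J)
    {U : Matrix (Fin K) (Fin J) ℍ[ℝ]} (hU : Uᴴ * U = 1) (A : Tensor d) :
    frobNorm (leftMul h Uᴴ A) ^ 2 ≤ frobNorm A ^ 2 := by
  have := frobNorm_sub_leftMul_leftMul_sq h hU A
  nlinarith [sq_nonneg (frobNorm (A - leftMul h.symm U (leftMul h Uᴴ A)))]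

/-! ### Unfoldings and mode products -/

theorem splitIndex_symm_eq_replace (h : ModeChange d d k K K) (i : ∀ j, Fin (d j)) (a : Fin K) :
    (splitIndex d k).symm (Fin.cast h.source.symm a, (splitIndex d k i).2) = h.replace i a := by
  rw [Equiv.symm_apply_eq]
  refine Prod.ext ?_ (Fin.ext ?_)
  · rw [splitIndex_fst, h.replace_self]
  · rw [splitIndex_snd, splitIndex_snd]
    refine Finset.sum_congr rfl fun l _ => ?_
    rw [h.replace_of_ne _ _ (otherModes k l).2]
    rfl

theorem foldL_mul_unfoldL (hk : d k = K) (W : Matrix (Fin K) (Fin K) ℍ[ℝ]) (A : Tensor d) :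
    foldL k hk (W * unfoldL k hk A) = leftMul (.refl hk) W A := by
  funext i
  simp only [foldL, unfoldL, leftMul, Matrix.mul_apply, splitIndex_fst]
  exact Finset.sum_congr rfl fun a _ => by rw [splitIndex_symm_eq_replace (.refl hk)]

theorem foldR_unfoldR_mul (hk : d k = K) (W : Matrix (Fin K) (Fin K) ℍ[ℝ]) (A : Tensor d) :
    foldR k hk (unfoldR k hk A * W) = rightMul (.refl hk) A W := by
  funext i
  simp only [foldR, unfoldR, rightMul, Matrix.mul_apply, splitIndex_fst]
  exact Finset.sum_congr rfl fun a _ => by rw [splitIndex_symm_eq_replace (.refl hk)]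

theorem frobNorm_foldL_sq (hk : d k = K) (M : Matrix (Fin K) (Fin (codim d k)) ℍ[ℝ]) :
    frobNorm (foldL k hk M) ^ 2 = matrixNormSq M := by
  subst hk
  rw [frobNorm_sq, matrixNormSq, ← Fintype.sum_prod_type',
    ← Equiv.sum_comp (splitIndex d k)]
  rfl

theorem frobNorm_foldR_sq (hk : d k = K) (M : Matrix (Fin (codim d k)) (Fin K) ℍ[ℝ]) :
    frobNorm (foldR k hk M) ^ 2 = matrixNormSq M := by
  subst hk
  rw [frobNorm_sq, matrixNormSq, Finset.sum_comm, ← Fintype.sum_prod_type',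
    ← Equiv.sum_comp (splitIndex d k)]
  rfl

end ModeProducts

/-! ### Truncation and expansion -/

section Expansion

variable {m : ℕ} {I r : Fin (2 * m) → ℕ}
  {Uhat : ∀ s : Fin m, Matrix (Fin (I (modeL s))) (Fin (r (modeL s))) ℍ[ℝ]}
  {Vhat : ∀ s : Fin m, Matrix (Fin (I (modeR s))) (Fin (r (modeR s))) ℍ[ℝ]}

theorem modeL_ne_modeR (s t : Fin m) : modeL s ≠ modeR t := fun h => by
  have := congrArg Fin.val h
  simp only [modeL, modeR] at this
  omega

theorem expandL_rightMul {a b : ℕ} (ha : a ≤ m) (hb : b < m) (X : Tensor (dims I r a (b + 1)))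
    (V : Matrix (Fin (r (modeR ⟨b, hb⟩))) (Fin (I (modeR ⟨b, hb⟩))) ℍ[ℝ]) :
    expandL Uhat a ha (rightMul (modeChangeR I r ⟨b, hb⟩ a).symm X V) =
      rightMul (modeChangeR I r ⟨b, hb⟩ 0).symm (expandL Uhat a ha X) V := by
  induction a with
  | zero => rfl
  | succ a ih =>
    rw [expandL, expandL, ← ih (by omega)]
    congr 1
    exact (rightMul_leftMul (modeL_ne_modeR _ _) _ _ _ _ _ _ _).symm

theorem frobNorm_expandL_sq (hU : ∀ s, (Uhat s)ᴴ * Uhat s = 1) {a b : ℕ} (ha : a ≤ m)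
    (X : Tensor (dims I r a b)) : frobNorm (expandL Uhat a ha X) ^ 2 = frobNorm X ^ 2 := by
  induction a with
  | zero => rfl
  | succ a ih => rw [expandL, ih, frobNorm_leftMul_sq _ (hU _)]

theorem frobNorm_expandR_sq (hV : ∀ s, (Vhat s)ᴴ * Vhat s = 1) {a b : ℕ} (hb : b ≤ m)
    (X : Tensor (dims I r a b)) : frobNorm (expandR Vhat b hb X) ^ 2 = frobNorm X ^ 2 := by
  induction b with
  | zero => rfl
  | succ b ih => rw [expandR, ih, frobNorm_rightMul_sq _ (hV _)]

/-- Expansion is the adjoint of the truncation procedure. -/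
theorem tensorInner_stage (T : Tensor I) {s : ℕ} (hs : s ≤ m) (Y : Tensor (dims I r s s)) :
    tensorInner (stage T Uhat Vhat 0 m.zero_le) (expandR Vhat s hs (expandL Uhat s hs Y)) =
      tensorInner (stage T Uhat Vhat s hs) Y := by
  induction s with
  | zero => rfl
  | succ s ih =>
    rw [expandR, expandL, ← expandL_rightMul _ hs, ih (by omega), stage, tensorInner_rightMul,
      tensorInner_leftMul, Matrix.conjTranspose_conjTranspose]
    congr 1
    exact rightMul_leftMul (modeL_ne_modeR _ _) _ _ _ _ _ _ _

theorem frobNorm_sub_expand_sq (T : Tensor I) (hU : ∀ s, (Uhat s)ᴴ * Uhat s = 1)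
    (hV : ∀ s, (Vhat s)ᴴ * Vhat s = 1) :
    frobNorm (stage T Uhat Vhat 0 m.zero_le -
        expandR Vhat m le_rfl (expandL Uhat m le_rfl (stage T Uhat Vhat m le_rfl))) ^ 2 =
      frobNorm (stage T Uhat Vhat 0 m.zero_le) ^ 2 -
        frobNorm (stage T Uhat Vhat m le_rfl) ^ 2 := by
  have hnorm := (frobNorm_expandR_sq hV le_rfl
    (expandL Uhat m le_rfl (stage T Uhat Vhat m le_rfl))).trans (frobNorm_expandL_sq hU le_rfl _)
  rw [frobNorm_sub_sq, hnorm]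
  rw [tensorInner_stage, tensorInner_self, hnorm]

theorem frobNorm_stage_sub_sq (T : Tensor I) {g : Fin m → ℝ}
    (hg : ∀ s : Fin m, frobNorm (stage T Uhat Vhat s s.2.le) ^ 2 -
      frobNorm (stage T Uhat Vhat (s + 1) s.2) ^ 2 = g s) {a : ℕ} (ha : a ≤ m) :
    frobNorm (stage T Uhat Vhat 0 m.zero_le) ^ 2 - frobNorm (stage T Uhat Vhat a ha) ^ 2 =
      ∑ s : Fin a, g (Fin.castLE ha s) := by
  induction a with
  | zero => simp
  | succ a ih =>
    rw [Fin.sum_univ_castSucc]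
    have h₁ := ih (by omega)
    have h₂ := hg ⟨a, ha⟩
    change _ = (∑ s : Fin a, g (Fin.castLE (by omega) s)) + g ⟨a, ha⟩
    rw [← h₁, ← h₂]
    simp

end Expansion

/-! ### Residuals -/

namespace TruncatedDecomposition

variable {m : ℕ} {I : Fin (2 * m) → ℕ} {T : Tensor I} {r : Fin (2 * m) → ℕ} {hr : ∀ k, r k ≤ I k}
  (D : TruncatedDecomposition T r hr)

theorem Uhat_conjTranspose_mul_self (s : Fin m) : (D.Uhat s)ᴴ * D.Uhat s = 1 :=
  headCols_conjTranspose_mul_self _ (D.svdL s).conjTranspose_mul_left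

theorem Vhat_conjTranspose_mul_self (s : Fin m) : (D.Vhat s)ᴴ * D.Vhat s = 1 :=
  headCols_conjTranspose_mul_self _ (D.svdR s).conjTranspose_mul_right

theorem resL_eq (s : Fin m) :
    D.resL s = stage T D.Uhat D.Vhat s s.2.le -
      leftMul (modeChangeL I r s s).symm (D.Uhat s)
        (leftMul (modeChangeL I r s s) (D.Uhat s)ᴴ (stage T D.Uhat D.Vhat s s.2.le)) := by
  rw [resL, (D.svdL s).discardL_eq, foldL_mul_unfoldL, sub_leftMul, leftMul_one,
    leftMul_leftMul _ _ (.refl (modeChangeL I r s s).source)]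
  rfl

theorem resR_eq (s : Fin m) :
    D.resR s = stage T D.Uhat D.Vhat s s.2.le -
      rightMul (modeChangeR I r s s).symm
        (rightMul (modeChangeR I r s s) (stage T D.Uhat D.Vhat s s.2.le) (D.Vhat s))
        (D.Vhat s)ᴴ := by
  rw [resR, (D.svdR s).discardR_eq, foldR_unfoldR_mul, rightMul_sub, rightMul_one,
    rightMul_rightMul _ _ (.refl (modeChangeR I r s s).source)]
  rfl

theorem frobNorm_resL_sq (s : Fin m) :
    frobNorm (D.resL s) ^ 2 = ∑ i ∈ Finset.Ico (r (modeL s)) (I (modeL s)), D.σL s i ^ 2 :=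
  (frobNorm_foldL_sq _ _).trans ((D.svdL s).matrixNormSq_discardL _)

theorem frobNorm_resR_sq (s : Fin m) :
    frobNorm (D.resR s) ^ 2 = ∑ i ∈ Finset.Ico (r (modeR s)) (I (modeR s)), D.σR s i ^ 2 :=
  (frobNorm_foldR_sq _ _).trans ((D.svdR s).matrixNormSq_discardR _)

/-- The loss in one step, when the left truncation is performed first. -/
theorem frobNorm_stage_sub_eq_left (s : Fin m) :
    frobNorm (stage T D.Uhat D.Vhat s s.2.le) ^ 2 -
        frobNorm (stage T D.Uhat D.Vhat (s + 1) s.2) ^ 2 =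
      frobNorm (D.resL s) ^ 2 +
        frobNorm (leftMul (modeChangeL I r s s) (D.Uhat s)ᴴ (D.resR s)) ^ 2 := by
  set X := stage T D.Uhat D.Vhat s s.2.le
  have hres : leftMul (modeChangeL I r s s) (D.Uhat s)ᴴ (D.resR s) =
      leftMul (modeChangeL I r s s) (D.Uhat s)ᴴ X -
        rightMul (modeChangeR I r s (s + 1)).symm (rightMul (modeChangeR I r s (s + 1))
          (leftMul (modeChangeL I r s s) (D.Uhat s)ᴴ X) (D.Vhat s)) (D.Vhat s)ᴴ := by
    rw [resR_eq, leftMul_sub,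
      rightMul_leftMul (modeL_ne_modeR s s) _ _ (modeChangeR I r s s) (modeChangeL I r s (s + 1)),
      rightMul_leftMul (modeL_ne_modeR s s) _ _ (modeChangeR I r s s).symm (modeChangeL I r s s)]
  have hstage : stage T D.Uhat D.Vhat (s + 1) s.2 = rightMul (modeChangeR I r s (s + 1))
      (leftMul (modeChangeL I r s s) (D.Uhat s)ᴴ X) (D.Vhat s) := rfl
  rw [hres, hstage, frobNorm_sub_rightMul_rightMul_sq _ (D.Vhat_conjTranspose_mul_self s), resL_eq,
    frobNorm_sub_leftMul_leftMul_sq _ (D.Uhat_conjTranspose_mul_self s)]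
  ring

/-- The loss in one step, when the right truncation is performed first. -/
theorem frobNorm_stage_sub_eq_right (s : Fin m) :
    frobNorm (stage T D.Uhat D.Vhat s s.2.le) ^ 2 -
        frobNorm (stage T D.Uhat D.Vhat (s + 1) s.2) ^ 2 =
      frobNorm (rightMul (modeChangeR I r s s) (D.resL s) (D.Vhat s)) ^ 2 +
        frobNorm (D.resR s) ^ 2 := by
  set X := stage T D.Uhat D.Vhat s s.2.le
  have hres : rightMul (modeChangeR I r s s) (D.resL s) (D.Vhat s) =
      rightMul (modeChangeR I r s s) X (D.Vhat s) -
        leftMul (modeChangeL I r s (s + 1)).symm (D.Uhat s) (leftMul (modeChangeL I r s (s + 1))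
          (D.Uhat s)ᴴ (rightMul (modeChangeR I r s s) X (D.Vhat s))) := by
    rw [resL_eq, sub_rightMul,
      rightMul_leftMul (modeL_ne_modeR s s) _ _ (modeChangeR I r s (s + 1))
        (modeChangeL I r s (s + 1)).symm,
      rightMul_leftMul (modeL_ne_modeR s s) _ _ (modeChangeR I r s s) (modeChangeL I r s (s + 1))]
  have hstage : stage T D.Uhat D.Vhat (s + 1) s.2 = leftMul (modeChangeL I r s (s + 1))
      (D.Uhat s)ᴴ (rightMul (modeChangeR I r s s) X (D.Vhat s)) :=
    rightMul_leftMul (modeL_ne_modeR s s) _ _ _ _ _ _ _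
  rw [hres, hstage, frobNorm_sub_leftMul_leftMul_sq _ (D.Uhat_conjTranspose_mul_self s), resR_eq,
    frobNorm_sub_rightMul_rightMul_sq _ (D.Vhat_conjTranspose_mul_self s)]
  ring

/-- The squared error is the sum of the losses in the steps. -/
theorem frobNorm_sub_approx_sq {g : Fin m → ℝ}
    (hg : ∀ s : Fin m, frobNorm (stage T D.Uhat D.Vhat s s.2.le) ^ 2 -
      frobNorm (stage T D.Uhat D.Vhat (s + 1) s.2) ^ 2 = g s) :
    frobNorm (T - D.approx) ^ 2 = ∑ s, g s := by
  rw [approx, frobNorm_sub_castDims (dims_zero I r)]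
  exact (frobNorm_sub_expand_sq T D.Uhat_conjTranspose_mul_self
    D.Vhat_conjTranspose_mul_self).trans (frobNorm_stage_sub_sq T hg le_rfl)

end TruncatedDecomposition

end TSQHOSVD

theorem theorem5p3 {m : ℕ} {I : Fin (2 * m) → ℕ} (T : TSQHOSVD.Tensor I)
    (r : Fin (2 * m) → ℕ) (hr : ∀ k, r k ≤ I k)
    (D : TSQHOSVD.TruncatedDecomposition T r hr) :
    TSQHOSVD.frobNorm (T - D.approx) ^ 2 =
        ∑ s : Fin m, TSQHOSVD.frobNorm (D.resL s) ^ 2 +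
          ∑ s : Fin m, TSQHOSVD.frobNorm
            (TSQHOSVD.leftMul (TSQHOSVD.modeChangeL I r s s) (D.Uhat s)ᴴ (D.resR s)) ^ 2 ∧
    TSQHOSVD.frobNorm (T - D.approx) ^ 2 =
        ∑ s : Fin m, TSQHOSVD.frobNorm
            (TSQHOSVD.rightMul (TSQHOSVD.modeChangeR I r s s) (D.resL s) (D.Vhat s)) ^ 2 +
          ∑ s : Fin m, TSQHOSVD.frobNorm (D.resR s) ^ 2 ∧
    TSQHOSVD.frobNorm (T - D.approx) ^ 2 ≤
        ∑ s : Fin m, ∑ i ∈ Finset.Ico (r (TSQHOSVD.modeL s)) (I (TSQHOSVD.modeL s)),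
            D.σL s i ^ 2 +
          ∑ s : Fin m, ∑ i ∈ Finset.Ico (r (TSQHOSVD.modeR s)) (I (TSQHOSVD.modeR s)),
            D.σR s i ^ 2 := by
  have hleft := D.frobNorm_sub_approx_sq D.frobNorm_stage_sub_eq_left
  have hright := D.frobNorm_sub_approx_sq D.frobNorm_stage_sub_eq_right
  rw [Finset.sum_add_distrib] at hleft hright
  refine ⟨hleft, hright, ?_⟩
  rw [hleft]
  simp only [← D.frobNorm_resL_sq, ← D.frobNorm_resR_sq]
  exact add_le_add le_rfl <| Finset.sum_le_sum fun s _ =>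
    TSQHOSVD.frobNorm_leftMul_conjTranspose_sq_le _ (D.Uhat_conjTranspose_mul_self s) _
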